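/- Let $K$ be a global function field, i.e. a finite extension of a rational function field $\mathbb{F}_q(x)$ over a finite field $\mathbb{F}_q$, and assume that $\operatorname{char} K \neq 3$. A place $\mathfrak{p}$ of $K$ is identified with its normalised discrete valuation $v_{\mathfrak{p}} : K \to \mathbb{Z}\cup\{\infty\}$ (trivial on $\mathbb{F}_q^{*}$). Let $L/K$ be an impurely cubic extension, that is, $[L:K]=3$ and $L/K$ has no primitive element with minimal polynomial of the form $X^3-b$, $b\in K$. Let $y$ be a primitive element of $L/K$ with minimal polynomial $X^3-3X-a$, where $a\in K$. Call a place $\mathfrak{p}$ of $K$ fully ramified in $L$ if there is exactly one place $\mathfrak{P}$ of $L$ above $\mathfrak{p}$ and its ramification index $e(\mathfrak{P}|\mathfrak{p})$, the positive integer $e$ such that $v_{\mathfrak{P}}(z)=e\,v_{\mathfrak{p}}(z)$ for all $z\in K$, equals $[L:K]=3$. Then the places of $K$ that are fully ramified in $L$ are precisely the places $\mathfrak{p}$ such that $$v_{\mathfrak{p}}(a)<0 \quad\text{and}\quad \gcd(v_{\mathfrak{p}}(a),3)=1 .$$ -/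

import Mathlib

open Polynomial IntermediateField
open scoped RatFunc

/-- A place of a function field `F` with field of constants `k`, given by its normalised discrete
valuation `v : F → ℤ ∪ {∞}`: it is trivial on the nonzero constants and takes every value
in `ℤ ∪ {∞}`. -/
@[ext]
structure Place (k F : Type*) [Field k] [Field F] [Algebra k F] where
  /-- The normalised valuation of the place. -/
  v : AddValuation F (WithTop ℤ)
  v_const : ∀ c : k, c ≠ 0 → v (algebraMap k F c) = 0
  v_surjective : Function.Surjective v

namespace Place

variable {k K L : Type*} [Field k] [Field K] [Field L] [Algebra k K] [Algebra k L] [Algebra K L]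

/-- `P` lies over `p`: the valuation ring of `P` meets `K` in the valuation ring of `p`. -/
def LiesOver (P : Place k L) (p : Place k K) : Prop :=
  ∀ z : K, 0 ≤ P.v (algebraMap K L z) ↔ 0 ≤ p.v z

/-- `e` is the ramification index `e(P|p)`: the positive integer with `v_P(z) = e * v_p(z)`
for all `z` in `K`. -/
def HasRamificationIdx (P : Place k L) (p : Place k K) (e : ℕ) : Prop :=
  0 < e ∧ ∀ z : K, P.v (algebraMap K L z) = e • p.v z

variable (L) in
/-- `p` is fully ramified in `L`: there is exactly one place `P` of `L` over `p`, and its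
ramification index is `[L : K]`. -/
def IsFullyRamified (p : Place k K) : Prop :=
  ∃ P : Place k L, P.LiesOver p ∧ (∀ Q : Place k L, Q.LiesOver p → Q = P) ∧
    P.HasRamificationIdx p (Module.finrank K L)

end Place

/-- The extension `L/K` is cubic and has a purely cubic generator, i.e. a primitive element
whose minimal polynomial is of the form `X ^ 3 - b` (used for characteristic different from 3). -/
def IsPurelyCubic (K L : Type*) [Field K] [Field L] [Algebra K L] : Prop :=
  Module.finrank K L = 3 ∧ ∃ u : L, K⟮u⟯ = ⊤ ∧ ∃ b : K, minpoly K u = X ^ 3 - C b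

/-- The extension `L/K` is cubic and has no purely cubic generator (used for characteristic
different from 3). -/
def IsImpurelyCubic (K L : Type*) [Field K] [Field L] [Algebra K L] : Prop :=
  Module.finrank K L = 3 ∧ ¬ IsPurelyCubic K L

/-! Everything rests on residues modulo 3. If `θ` has value prime to 3 at a place of index divisible
by 3, the nonzero monomials among `b₀`, `b₁ θ`, `b₂ θ ^ 2` have distinct values, so their sum has
the least of them (`map_quadratic`).

If `v a = n < 0` is prime to 3, the norm of `b₀ + b₁ y + b₂ y ^ 2` has the value `gauge` predicts,
so `gauge` is multiplicative and extends `3 • v` to `L`. At any place above `p` of index `e`, the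
equation forces `3 v(y) = e n`, hence `3 ∣ e`; the monomials then determine the place.

Conversely, expand `y` in powers of a uniformizer `t` of the totally ramified place. Subtracting the
constant term leaves `z` of value `d` prime to 3, and the cubic equation of `z` gives `v a = d < 0`.
-/

namespace WithTop

theorem nsmul_top_of_pos {f : ℕ} (hf : 0 < f) : f • (⊤ : WithTop ℤ) = ⊤ := by
  obtain ⟨m, rfl⟩ := Nat.exists_eq_succ_of_ne_zero hf.ne'
  rw [succ_nsmul, add_top]

theorem nsmul_coe_int (f : ℕ) (n : ℤ) : f • (n : WithTop ℤ) = ((f * n : ℤ) : WithTop ℤ) := by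
  rw [← WithTop.coe_nsmul, nsmul_eq_mul]

theorem strictMono_nsmul_int {f : ℕ} (hf : 0 < f) :
    StrictMono fun x : WithTop ℤ => f • x := by
  intro x y hxy
  induction x using WithTop.recTopCoe with
  | top => simp at hxy
  | coe x =>
    induction y using WithTop.recTopCoe with
    | top => simp only [nsmul_top_of_pos hf, nsmul_coe_int, WithTop.coe_lt_top]
    | coe y =>
      simp only [nsmul_coe_int, WithTop.coe_lt_coe] at hxy ⊢
      exact mul_lt_mul_of_pos_left hxy (by exact_mod_cast hf)

end WithTop

/-! ### Values of sums without ties -/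

namespace AddValuation

variable {K L : Type*} [Field K] [Field L]

theorem map_add_of_eq_imp_top (v : AddValuation K (WithTop ℤ)) {x y : K}
    (h : v x = v y → v x = ⊤) : v (x + y) = min (v x) (v y) := by
  by_cases hxy : v x = v y
  · have hx := h hxy
    have hx0 := v.top_iff.1 hx
    have hy0 := v.top_iff.1 (hxy ▸ hx)
    simp [hx0, hy0]
  · exact v.map_add_of_distinct_val hxy

theorem map_add_three_of_eq_imp_top (v : AddValuation K (WithTop ℤ)) {x y z : K}
    (hxy : v x = v y → v x = ⊤) (hxz : v x = v z → v x = ⊤) (hyz : v y = v z → v y = ⊤) :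
    v (x + y + z) = min (v x) (min (v y) (v z)) := by
  have h := v.map_add_of_eq_imp_top hxy
  rw [v.map_add_of_eq_imp_top, h, min_assoc]
  rw [h]
  rcases min_choice (v x) (v y) with e | e <;> rw [e] <;> assumption

/-- The least value of the monomials `b₀`, `b₁ θ`, `b₂ θ ^ 2`, where the values of the coefficients
are multiplied by `3` and `θ` has value `n`. -/
def gauge (v : AddValuation K (WithTop ℤ)) (n : ℤ) (b₀ b₁ b₂ : K) : WithTop ℤ :=
  min (3 • v b₀) (min (3 • v b₁ + (n : WithTop ℤ)) (3 • v b₂ + ((2 * n : ℤ) : WithTop ℤ)))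

/-- Finite values lie in the classes of 0, `n`, `2 n` modulo 3, which differ; a tie is possible only
at `⊤`, between zero terms. -/
theorem gauge_terms_distinct {n : ℤ} (hn : ¬ 3 ∣ n) (x y z : WithTop ℤ) :
    (3 • x = 3 • y + (n : WithTop ℤ) → 3 • x = ⊤) ∧
    (3 • x = 3 • z + ((2 * n : ℤ) : WithTop ℤ) → 3 • x = ⊤) ∧
    (3 • y + (n : WithTop ℤ) = 3 • z + ((2 * n : ℤ) : WithTop ℤ) →
      3 • y + (n : WithTop ℤ) = ⊤) := by
  have h3 : 0 < 3 := by norm_num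
  induction x using WithTop.recTopCoe <;> induction y using WithTop.recTopCoe <;>
    induction z using WithTop.recTopCoe <;>
    simp only [WithTop.nsmul_top_of_pos h3, WithTop.nsmul_coe_int, ← WithTop.coe_add,
      WithTop.top_add, WithTop.coe_ne_top, WithTop.top_ne_coe, WithTop.coe_inj, imp_true_iff,
      imp_false, and_true, true_and, not_false_eq_true] <;>
    push_cast <;> omega

theorem gauge_eq_top_iff (v : AddValuation K (WithTop ℤ)) (n : ℤ) (b₀ b₁ b₂ : K) :
    v.gauge n b₀ b₁ b₂ = ⊤ ↔ b₀ = 0 ∧ b₁ = 0 ∧ b₂ = 0 := by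
  have h (b : K) : 3 • v b = ⊤ ↔ b = 0 := by
    rw [← v.top_iff, ← WithTop.nsmul_top_of_pos (f := 3) (by norm_num)]
    exact (WithTop.strictMono_nsmul_int (f := 3) (by norm_num)).injective.eq_iff.trans
      (by rw [WithTop.nsmul_top_of_pos (by norm_num)])
  simp only [gauge, min_eq_top, WithTop.add_eq_top, WithTop.coe_ne_top, or_false, h]

theorem le_gauge_add (v : AddValuation K (WithTop ℤ)) (n : ℤ) (b₀ b₁ b₂ c₀ c₁ c₂ : K) :
    min (v.gauge n b₀ b₁ b₂) (v.gauge n c₀ c₁ c₂) ≤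
      v.gauge n (b₀ + c₀) (b₁ + c₁) (b₂ + c₂) := by
  have h (b c : K) (m : WithTop ℤ) :
      min (3 • v b + m) (3 • v c + m) ≤ 3 • v (b + c) + m := by
    rw [min_add_add_right]
    gcongr
    have hmono := (WithTop.strictMono_nsmul_int (f := 3) (by norm_num)).monotone
    rw [← hmono.map_min]
    exact hmono (v.map_add b c)
  have h₀ := h b₀ c₀ 0
  simp only [add_zero] at h₀
  have h₁ := h b₁ c₁ n
  have h₂ := h b₂ c₂ ((2 * n : ℤ) : WithTop ℤ)
  unfold gauge
  refine le_min (le_trans ?_ h₀) (le_min (le_trans ?_ h₁) (le_trans ?_ h₂))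
  · exact min_le_min (min_le_left _ _) (min_le_left _ _)
  · exact min_le_min ((min_le_right _ _).trans (min_le_left _ _))
      ((min_le_right _ _).trans (min_le_left _ _))
  · exact min_le_min ((min_le_right _ _).trans (min_le_right _ _))
      ((min_le_right _ _).trans (min_le_right _ _))

/-- If `w` extends `3 f • v` and `θ` has value `f n` with `n` prime to `3`, the value of a
quadratic expression in `θ` is the least value of its monomials. -/
theorem map_quadratic [Algebra K L] (v : AddValuation K (WithTop ℤ))
    (w : AddValuation L (WithTop ℤ)) {f : ℕ} (hf : 0 < f) {n : ℤ} (hn : ¬ 3 ∣ n)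
    (hw : ∀ z, w (algebraMap K L z) = (3 * f) • v z) {θ : L}
    (hθ : w θ = ((f * n : ℤ) : WithTop ℤ)) (b₀ b₁ b₂ : K) :
    w (algebraMap K L b₀ + algebraMap K L b₁ * θ + algebraMap K L b₂ * θ ^ 2) =
      f • v.gauge n b₀ b₁ b₂ := by
  have hmono := WithTop.strictMono_nsmul_int hf
  have e₀ : w (algebraMap K L b₀) = f • (3 • v b₀) := by rw [hw, mul_comm, mul_nsmul']
  have e₁ : w (algebraMap K L b₁ * θ) = f • (3 • v b₁ + (n : WithTop ℤ)) := by
    rw [map_mul, hw, hθ, nsmul_add, mul_comm, mul_nsmul', WithTop.nsmul_coe_int]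
  have e₂ : w (algebraMap K L b₂ * θ ^ 2) = f • (3 • v b₂ + ((2 * n : ℤ) : WithTop ℤ)) := by
    rw [map_mul, map_pow, hw, hθ, nsmul_add, mul_comm, mul_nsmul', WithTop.nsmul_coe_int,
      WithTop.nsmul_coe_int]
    congr 2
    push_cast
    ring
  obtain ⟨d₁, d₂, d₃⟩ := gauge_terms_distinct hn (v b₀) (v b₁) (v b₂)
  have key {s t : WithTop ℤ} (h : s = t → s = ⊤) : f • s = f • t → f • s = ⊤ := fun hst => by
    rw [h (hmono.injective hst), WithTop.nsmul_top_of_pos hf]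
  rw [map_add_three_of_eq_imp_top, e₀, e₁, e₂, gauge, hmono.monotone.map_min (f := fun x => f • x),
    hmono.monotone.map_min (f := fun x => f • x)]
  · rw [e₀, e₁]; exact key d₁
  · rw [e₀, e₂]; exact key d₂
  · rw [e₁, e₂]; exact key d₃

end AddValuation

/-- Three elements of a cubic extension satisfying no linear relation span it. -/
theorem exists_eq_quadratic {K L : Type*} [Field K] [Field L] [Algebra K L]
    (hfin : Module.finrank K L = 3) {θ : L}
    (hθ : ∀ b₀ b₁ b₂ : K, algebraMap K L b₀ + algebraMap K L b₁ * θ + algebraMap K L b₂ * θ ^ 2 = 0 →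
      b₀ = 0 ∧ b₁ = 0 ∧ b₂ = 0) (x : L) :
    ∃ b₀ b₁ b₂ : K,
      x = algebraMap K L b₀ + algebraMap K L b₁ * θ + algebraMap K L b₂ * θ ^ 2 := by
  have hli : LinearIndependent K ![1, θ, θ ^ 2] := by
    rw [Fintype.linearIndependent_iff]
    intro g hg
    simp only [Fin.sum_univ_three, Matrix.cons_val, Algebra.smul_def, mul_one] at hg
    obtain ⟨h₀, h₁, h₂⟩ := hθ _ _ _ hg
    intro i
    fin_cases i <;> assumption
  have hspan := hli.span_eq_top_of_card_eq_finrank (by simp [hfin])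
  have hx : x ∈ Submodule.span K (Set.range ![1, θ, θ ^ 2]) := hspan ▸ Submodule.mem_top
  obtain ⟨c, rfl⟩ := (Submodule.mem_span_range_iff_exists_fun K).1 hx
  exact ⟨c 0, c 1, c 2, by simp [Fin.sum_univ_three, Algebra.smul_def]⟩

/-! ### The norm form and the extended valuation -/

section CubicNorm

variable {K L : Type*} [Field K] [Field L] [Algebra K L]

/-- The norm of `b₀ + b₁ y + b₂ y ^ 2`, where `y ^ 3 = 3 y + a`. -/
def cubicNorm (a b₀ b₁ b₂ : K) : K :=
  b₀ ^ 3 + a * b₁ ^ 3 + a ^ 2 * b₂ ^ 3 + (6 * (b₀ ^ 2 * b₂) - 3 * (b₀ * b₁ ^ 2) +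
    9 * (b₀ * b₂ ^ 2) - 3 * (a * b₀ * b₁ * b₂) - 3 * (a * b₁ * b₂ ^ 2))

/-- Multiplicativity of the norm: the arguments on the left are the coordinates of the product,
reduced by `y ^ 3 = 3 y + a`. -/
theorem cubicNorm_mul (a b₀ b₁ b₂ c₀ c₁ c₂ : K) :
    cubicNorm a (b₀ * c₀ + a * (b₁ * c₂ + b₂ * c₁))
      (b₀ * c₁ + b₁ * c₀ + 3 * (b₁ * c₂ + b₂ * c₁) + a * (b₂ * c₂))
      (b₀ * c₂ + b₁ * c₁ + b₂ * c₀ + 3 * (b₂ * c₂)) =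
    cubicNorm a b₀ b₁ b₂ * cubicNorm a c₀ c₁ c₂ := by
  unfold cubicNorm
  ring

theorem AddValuation.natCast_nonneg (v : AddValuation K (WithTop ℤ)) (m : ℕ) :
    0 ≤ v (m : K) := by
  induction m with
  | zero => simp
  | succ m ih => push_cast; exact v.map_le_add ih (by simp)

/-- The three diagonal terms have no ties, so their sum has value `gauge`; the cross terms are
strictly larger. -/
theorem AddValuation.map_cubicNorm (v : AddValuation K (WithTop ℤ)) {n : ℤ} (hn : ¬ 3 ∣ n)
    (hneg : n < 0) {a : K} (ha : v a = (n : WithTop ℤ)) (b₀ b₁ b₂ : K) :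
    v (cubicNorm a b₀ b₁ b₂) = v.gauge n b₀ b₁ b₂ := by
  have hdiag : v (b₀ ^ 3 + a * b₁ ^ 3 + a ^ 2 * b₂ ^ 3) = v.gauge n b₀ b₁ b₂ := by
    obtain ⟨d₁, d₂, d₃⟩ := gauge_terms_distinct hn (v b₀) (v b₁) (v b₂)
    have e₀ : v (b₀ ^ 3) = 3 • v b₀ := v.map_pow _ _
    have e₁ : v (a * b₁ ^ 3) = 3 • v b₁ + (n : WithTop ℤ) := by
      rw [v.map_mul, v.map_pow, ha, add_comm]
    have e₂ : v (a ^ 2 * b₂ ^ 3) = 3 • v b₂ + ((2 * n : ℤ) : WithTop ℤ) := by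
      rw [v.map_mul, v.map_pow, v.map_pow, ha, add_comm, WithTop.nsmul_coe_int]
      rfl
    rw [v.map_add_three_of_eq_imp_top, e₀, e₁, e₂, gauge]
    · rwa [e₀, e₁]
    · rwa [e₀, e₂]
    · rwa [e₁, e₂]
  by_cases h0 : b₀ = 0 ∧ b₁ = 0 ∧ b₂ = 0
  · obtain ⟨rfl, rfl, rfl⟩ := h0
    rw [(v.gauge_eq_top_iff n 0 0 0).2 ⟨rfl, rfl, rfl⟩]
    simp [cubicNorm]
  have htop : v.gauge n b₀ b₁ b₂ ≠ ⊤ := fun h => h0 ((v.gauge_eq_top_iff n b₀ b₁ b₂).1 h)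
  rw [cubicNorm, v.map_add_eq_of_lt_left, hdiag]
  rw [hdiag]
  have hint (m : ℕ) {x : K} (h : v.gauge n b₀ b₁ b₂ < v x) : v.gauge n b₀ b₁ b₂ < v (m * x) := by
    rw [v.map_mul]
    exact h.trans_le (le_add_of_nonneg_left (v.natCast_nonneg m))
  have h3 : 0 < 3 := by norm_num
  have h2 : 0 < 2 := by norm_num
  -- Averaging the bounds on the diagonal terms gives `≥`. The excess is a positive multiple of
  -- `-n`, except for `a b₀ b₁ b₂`, where equality would need all three diagonal values to agree.
  have hcross : v.gauge n b₀ b₁ b₂ < v (b₀ ^ 2 * b₂) ∧ v.gauge n b₀ b₁ b₂ < v (b₀ * b₁ ^ 2) ∧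
      v.gauge n b₀ b₁ b₂ < v (b₀ * b₂ ^ 2) ∧ v.gauge n b₀ b₁ b₂ < v (a * b₀ * b₁ * b₂) ∧
      v.gauge n b₀ b₁ b₂ < v (a * b₁ * b₂ ^ 2) := by
    simp only [gauge, v.map_mul, v.map_pow, ha] at htop ⊢
    generalize v b₀ = x at htop ⊢
    generalize v b₁ = y at htop ⊢
    generalize v b₂ = z at htop ⊢
    induction x using WithTop.recTopCoe <;> induction y using WithTop.recTopCoe <;>
      induction z using WithTop.recTopCoe <;>
      simp only [WithTop.nsmul_top_of_pos h3, WithTop.nsmul_top_of_pos h2,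
        WithTop.nsmul_coe_int, ← WithTop.coe_add, ← WithTop.coe_min, WithTop.coe_lt_coe,
        WithTop.top_add, WithTop.add_top, WithTop.coe_lt_top, min_top_left, min_top_right,
        and_true, true_and, ne_eq, not_true_eq_false] at htop ⊢ <;>
      push_cast <;> omega
  obtain ⟨c₁, c₂, c₃, c₄, c₅⟩ := hcross
  have hsub {x y : K} (hx : v.gauge n b₀ b₁ b₂ < v x) (hy : v.gauge n b₀ b₁ b₂ < v y) :
      v.gauge n b₀ b₁ b₂ < v (x - y) := (lt_min hx hy).trans_le (v.map_sub x y)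
  exact hsub (hsub (v.map_lt_add (hsub (hint 6 c₁) (hint 3 c₂)) (hint 9 c₃)) (hint 3 c₄))
    (hint 3 c₅)

/-- A valuation of `K` for which `a` has negative value prime to `3` extends to the cubic extension
generated by a root `y` of `X ^ 3 - 3 X - a`. -/
theorem AddValuation.exists_extension_of_cubic (hfin : Module.finrank K L = 3) {a : K} {y : L}
    (hy : y ^ 3 = 3 * y + algebraMap K L a)
    (hind : ∀ b₀ b₁ b₂ : K,
      algebraMap K L b₀ + algebraMap K L b₁ * y + algebraMap K L b₂ * y ^ 2 = 0 →
        b₀ = 0 ∧ b₁ = 0 ∧ b₂ = 0)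
    (v : AddValuation K (WithTop ℤ)) {n : ℤ} (hn : ¬ 3 ∣ n) (hneg : n < 0)
    (ha : v a = (n : WithTop ℤ)) :
    ∃ w : AddValuation L (WithTop ℤ), (∀ z, w (algebraMap K L z) = 3 • v z) ∧
      w y = (n : WithTop ℤ) := by
  choose c₀ c₁ c₂ hc using exists_eq_quadratic hfin hind
  have huniq {x : L} {b₀ b₁ b₂ : K}
      (h : x = algebraMap K L b₀ + algebraMap K L b₁ * y + algebraMap K L b₂ * y ^ 2) :
      c₀ x = b₀ ∧ c₁ x = b₁ ∧ c₂ x = b₂ := by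
    have := hind (c₀ x - b₀) (c₁ x - b₁) (c₂ x - b₂) (by
      simp only [_root_.map_sub]
      linear_combination h - hc x)
    simpa only [sub_eq_zero] using this
  have hmap (z : K) : c₀ (algebraMap K L z) = z ∧ c₁ (algebraMap K L z) = 0 ∧
      c₂ (algebraMap K L z) = 0 := huniq (by simp)
  have hmap' (z : K) : v.gauge n (c₀ (algebraMap K L z)) (c₁ (algebraMap K L z))
      (c₂ (algebraMap K L z)) = 3 • v z := by
    obtain ⟨h₀, h₁, h₂⟩ := hmap z
    rw [h₀, h₁, h₂]
    simp [gauge, WithTop.nsmul_top_of_pos]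
  refine ⟨AddValuation.of (fun x => v.gauge n (c₀ x) (c₁ x) (c₂ x)) ?_ ?_ ?_ ?_, ?_, ?_⟩
  · have := hmap' 0
    rwa [_root_.map_zero, v.map_zero, WithTop.nsmul_top_of_pos (by norm_num)] at this
  · have := hmap' 1
    rwa [_root_.map_one, v.map_one, nsmul_zero] at this
  · intro x x'
    obtain ⟨h₀, h₁, h₂⟩ := huniq (x := x + x') (b₀ := c₀ x + c₀ x') (b₁ := c₁ x + c₁ x')
      (b₂ := c₂ x + c₂ x') (by
        simp only [_root_.map_add]
        linear_combination hc x + hc x')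
    simp only [h₀, h₁, h₂]
    exact v.le_gauge_add _ _ _ _ _ _ _
  · intro x x'
    obtain ⟨h₀, h₁, h₂⟩ := huniq (x := x * x')
      (b₀ := c₀ x * c₀ x' + a * (c₁ x * c₂ x' + c₂ x * c₁ x'))
      (b₁ := c₀ x * c₁ x' + c₁ x * c₀ x' + 3 * (c₁ x * c₂ x' + c₂ x * c₁ x') + a * (c₂ x * c₂ x'))
      (b₂ := c₀ x * c₂ x' + c₁ x * c₁ x' + c₂ x * c₀ x' + 3 * (c₂ x * c₂ x')) (by
        simp only [_root_.map_add, _root_.map_mul, map_ofNat]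
        conv_lhs => rw [hc x, hc x']
        linear_combination
          (algebraMap K L (c₁ x) * algebraMap K L (c₂ x') +
            algebraMap K L (c₂ x) * algebraMap K L (c₁ x') +
            algebraMap K L (c₂ x) * algebraMap K L (c₂ x') * y) * hy)
    simp only [h₀, h₁, h₂]
    rw [← v.map_cubicNorm hn hneg ha, cubicNorm_mul, v.map_mul, v.map_cubicNorm hn hneg ha,
      v.map_cubicNorm hn hneg ha]
  · exact hmap'
  · obtain ⟨h₀, h₁, h₂⟩ := huniq (x := y) (b₀ := 0) (b₁ := 1) (b₂ := 0) (by simp)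
    rw [AddValuation.of_apply]
    simp [h₀, h₁, h₂, gauge, WithTop.nsmul_top_of_pos]

end CubicNorm

/-! ### Places and ramification indices -/

namespace Place

variable {k K L : Type*} [Field k] [Field K] [Field L] [Algebra k K] [Algebra k L] [Algebra K L]

theorem map_intCast_eq_zero (p : Place k K) {m : ℤ} (hm : (m : K) ≠ 0) : p.v (m : K) = 0 := by
  have hk : (m : k) ≠ 0 := by
    intro h
    apply hm
    rw [← map_intCast (algebraMap k K), h, map_zero]
  rw [← map_intCast (algebraMap k K), p.v_const _ hk]

theorem exists_coe_of_ne_zero (p : Place k K) {z : K} (hz : z ≠ 0) :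
    ∃ m : ℤ, p.v z = (m : WithTop ℤ) := by
  obtain ⟨m, hm⟩ := WithTop.ne_top_iff_exists.1 (p.v.ne_top_iff.2 hz)
  exact ⟨m, hm.symm⟩

theorem HasRamificationIdx.liesOver {P : Place k L} {p : Place k K} {e : ℕ}
    (h : P.HasRamificationIdx p e) : P.LiesOver p := by
  intro z
  rw [h.2 z, ← (WithTop.strictMono_nsmul_int h.1).le_iff_le (a := 0) (b := p.v z), nsmul_zero]

/-- Units at `p` stay units at `P`, and each nonzero `z` is a unit times a power of a uniformizer
`t`; so `e` is the value of `t` at `P`. -/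
theorem LiesOver.exists_hasRamificationIdx {P : Place k L} {p : Place k K} (h : P.LiesOver p) :
    ∃ e, P.HasRamificationIdx p e := by
  obtain ⟨t, ht⟩ := p.v_surjective ((1 : ℤ) : WithTop ℤ)
  have ht0 : t ≠ 0 := p.v.ne_top_iff.1 (by rw [ht]; exact WithTop.coe_ne_top)
  have htL : algebraMap K L t ≠ 0 := (_root_.map_ne_zero _).2 ht0
  obtain ⟨e, he⟩ := P.exists_coe_of_ne_zero htL
  have hunit {z : K} (hz : p.v z = 0) : P.v (algebraMap K L z) = 0 := by
    have h₁ := (h z).2 hz.ge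
    have h₂ := (h z⁻¹).2 (by rw [p.v.map_inv, hz, neg_zero])
    have hz0 : z ≠ 0 := p.v.ne_top_iff.1 (by rw [hz]; exact WithTop.coe_ne_top)
    have h₃ : P.v (algebraMap K L z) + P.v (algebraMap K L z⁻¹) = 0 := by
      rw [← P.v.map_mul, ← map_mul, mul_inv_cancel₀ hz0, map_one, P.v.map_one]
    exact le_antisymm (h₃ ▸ le_add_of_nonneg_right h₂) h₁
  have hpos : 0 < e := by
    have h₁ : ¬ 0 ≤ P.v (algebraMap K L t⁻¹) := by
      rw [h, p.v.map_inv, ht]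
      decide
    rw [map_inv₀, P.v.map_inv, he, ← WithTop.LinearOrderedAddCommGroup.coe_neg] at h₁
    have h₂ : ¬ 0 ≤ -e := fun h => h₁ (by exact_mod_cast h)
    omega
  lift e to ℕ using hpos.le
  refine ⟨e, by exact_mod_cast hpos, ?_⟩
  have hnat (m : ℕ) {z : K} (hz : p.v z = ((m : ℤ) : WithTop ℤ)) :
      P.v (algebraMap K L z) = e • p.v z := by
    have hu : p.v (z / t ^ m) = 0 := by
      rw [p.v.map_div, p.v.map_pow, hz, ht, WithTop.nsmul_coe_int, mul_one]
      exact LinearOrderedAddCommGroupWithTop.sub_self_eq_zero_of_ne_top WithTop.coe_ne_top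
    have hzt : z = z / t ^ m * t ^ m := (div_mul_cancel₀ _ (pow_ne_zero _ ht0)).symm
    conv_lhs => rw [hzt]
    rw [map_mul, P.v.map_mul, hunit hu, map_pow, P.v.map_pow, he, hz, WithTop.nsmul_coe_int,
      WithTop.nsmul_coe_int, zero_add, mul_comm]
  intro z
  by_cases hz : z = 0
  · rw [hz, map_zero, P.v.map_zero, p.v.map_zero,
      WithTop.nsmul_top_of_pos (by exact_mod_cast hpos)]
  obtain ⟨m, hm⟩ := p.exists_coe_of_ne_zero hz
  obtain ⟨j, rfl | rfl⟩ := m.eq_nat_or_neg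
  · exact hnat j hm
  · have hi := hnat j (z := z⁻¹) (by
      rw [p.v.map_inv, hm, ← WithTop.LinearOrderedAddCommGroup.coe_neg, neg_neg])
    obtain ⟨i, hi'⟩ := P.exists_coe_of_ne_zero ((_root_.map_ne_zero (algebraMap K L)).2 hz)
    rw [map_inv₀, P.v.map_inv, p.v.map_inv, hm, hi', ← WithTop.LinearOrderedAddCommGroup.coe_neg,
      ← WithTop.LinearOrderedAddCommGroup.coe_neg, WithTop.nsmul_coe_int, WithTop.coe_inj] at hi
    rw [hi', hm, WithTop.nsmul_coe_int, WithTop.coe_inj]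
    linarith

/-! ### The two implications -/

variable {a : K} {y : L}

/-- If `p.v a` is negative and prime to `3`, then `p` is fully ramified in the cubic extension
generated by a root of `X ^ 3 - 3 X - a`. -/
theorem isFullyRamified_of_cubic [IsScalarTower k K L] (hfin : Module.finrank K L = 3)
    (hy : y ^ 3 = 3 * y + algebraMap K L a)
    (hind : ∀ b₀ b₁ b₂ : K,
      algebraMap K L b₀ + algebraMap K L b₁ * y + algebraMap K L b₂ * y ^ 2 = 0 →
        b₀ = 0 ∧ b₁ = 0 ∧ b₂ = 0)
    (p : Place k K) {n : ℤ} (hn : ¬ 3 ∣ n) (hneg : n < 0) (ha : p.v a = (n : WithTop ℤ)) :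
    p.IsFullyRamified L := by
  obtain ⟨w, hw, hwy⟩ := p.v.exists_extension_of_cubic hfin hy hind hn hneg ha
  have hspan := exists_eq_quadratic hfin hind
  have hsurj : Function.Surjective w := by
    intro x
    induction x using WithTop.recTopCoe with
    | top => exact ⟨0, w.map_zero⟩
    | coe x =>
      -- `n` is invertible modulo 3.
      obtain ⟨i, m, hx⟩ : ∃ (i : ℕ) (m : ℤ), x = 3 * m + i * n := by
        have h : n % 3 = 1 ∨ n % 3 = 2 := by omega
        have h' : x % 3 = 0 ∨ x % 3 = 1 ∨ x % 3 = 2 := by omega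
        rcases h with h | h <;> rcases h' with h' | h' | h'
        · exact ⟨0, x / 3, by push_cast; omega⟩
        · exact ⟨1, (x - n) / 3, by push_cast; omega⟩
        · exact ⟨2, (x - 2 * n) / 3, by push_cast; omega⟩
        · exact ⟨0, x / 3, by push_cast; omega⟩
        · exact ⟨2, (x - 2 * n) / 3, by push_cast; omega⟩
        · exact ⟨1, (x - n) / 3, by push_cast; omega⟩
      obtain ⟨z, hz⟩ := p.v_surjective (m : WithTop ℤ)
      refine ⟨algebraMap K L z * y ^ i, ?_⟩
      rw [w.map_mul, w.map_pow, hw, hz, hwy, WithTop.nsmul_coe_int, WithTop.nsmul_coe_int, hx]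
      rfl
  let P : Place k L :=
    { v := w
      v_const := fun c hc => by
        rw [IsScalarTower.algebraMap_apply k K L, hw, p.v_const c hc, nsmul_zero]
      v_surjective := hsurj }
  have hP : P.HasRamificationIdx p 3 := ⟨by norm_num, hw⟩
  refine ⟨P, hP.liesOver, ?_, hfin ▸ hP⟩
  intro Q hQ
  obtain ⟨e, he, hQe⟩ := hQ.exists_hasRamificationIdx
  have hQa : Q.v (algebraMap K L a) = ((e * n : ℤ) : WithTop ℤ) := by
    rw [hQe, ha, WithTop.nsmul_coe_int]
  have hen : (e : ℤ) * n < 0 := mul_neg_of_pos_of_neg (by exact_mod_cast he) hneg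
  have hy0 : y ≠ 0 := by
    rintro rfl
    have := hind 0 1 0 (by simp)
    simp at this
  obtain ⟨s, hs⟩ := Q.exists_coe_of_ne_zero hy0
  have h3s : 3 * s = e * n := by
    have hy3 : Q.v (y ^ 3) = ((3 * s : ℤ) : WithTop ℤ) := by
      rw [Q.v.map_pow, hs, WithTop.nsmul_coe_int]; rfl
    have h3y : ((s : ℤ) : WithTop ℤ) ≤ Q.v (3 * y) := by
      rw [Q.v.map_mul, hs]
      exact le_add_of_nonneg_left (by exact_mod_cast Q.v.natCast_nonneg 3)
    -- If `e n < s`, then `a` dominates `3 y`; otherwise `s ≤ e n < 0`, so `3 s < s` and `y ^ 3`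
    -- dominates `3 y`.
    by_cases hlt : e * n < s
    · have : Q.v (y ^ 3) = ((e * n : ℤ) : WithTop ℤ) := by
        rw [hy, Q.v.map_add_eq_of_lt_right, hQa]
        rw [hQa]
        exact (WithTop.coe_lt_coe.2 hlt).trans_le h3y
      rw [hy3] at this
      exact WithTop.coe_inj.1 this
    · have hay : algebraMap K L a = y ^ 3 - 3 * y := by rw [hy]; ring
      have : Q.v (algebraMap K L a) = ((3 * s : ℤ) : WithTop ℤ) := by
        rw [hay, Q.v.map_sub_eq_of_lt_left, hy3]
        rw [hy3]
        exact (WithTop.coe_lt_coe.2 (by omega)).trans_le h3y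
      rw [hQa] at this
      exact (WithTop.coe_inj.1 this).symm
  obtain ⟨f, rfl⟩ : 3 ∣ e := by
    have : (3 : ℤ) ∣ e :=
      ((Int.prime_three.dvd_mul.1 (Dvd.intro _ h3s)).resolve_right hn)
    exact_mod_cast this
  have hf : 0 < f := by omega
  have hQy : Q.v y = ((f * n : ℤ) : WithTop ℤ) := by
    rw [hs, WithTop.coe_inj]
    push_cast at h3s
    linarith
  have hQP (x : L) : Q.v x = f • P.v x := by
    obtain ⟨b₀, b₁, b₂, rfl⟩ := hspan x
    rw [p.v.map_quadratic Q.v hf hn hQe hQy, p.v.map_quadratic P.v one_pos hn hw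
      (by simpa using hwy), one_nsmul]
  obtain ⟨x, hx⟩ := Q.v_surjective ((1 : ℤ) : WithTop ℤ)
  have hf1 : f = 1 := by
    have hx0 : x ≠ 0 := Q.v.ne_top_iff.1 (by rw [hx]; exact WithTop.coe_ne_top)
    obtain ⟨m, hm⟩ := P.exists_coe_of_ne_zero hx0
    rw [hQP, hm, WithTop.nsmul_coe_int, WithTop.coe_inj] at hx
    exact_mod_cast Int.eq_one_of_mul_eq_one_right (by positivity) hx
  apply Place.ext
  ext x
  rw [hQP, hf1, one_nsmul]

/-- If `p` is fully ramified in a cubic extension containing a root of `X ^ 3 - 3 X - a` that is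
not in `K`, then `p.v a` is negative and prime to `3`. -/
theorem IsFullyRamified.value_of_cubic (hchar : (3 : K) ≠ 0) (hfin : Module.finrank K L = 3)
    (hy : y ^ 3 = 3 * y + algebraMap K L a) (hyK : ∀ b : K, y ≠ algebraMap K L b)
    {p : Place k K} (hp : p.IsFullyRamified L) :
    ∃ n : ℤ, p.v a = (n : WithTop ℤ) ∧ n < 0 ∧ ¬ 3 ∣ n := by
  obtain ⟨P, -, -, -, hP⟩ := hp
  rw [hfin] at hP
  obtain ⟨t, ht⟩ := P.v_surjective ((1 : ℤ) : WithTop ℤ)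
  have hquad := p.v.map_quadratic P.v (f := 1) one_pos (n := 1) (by norm_num) hP (θ := t)
    (by simpa using ht)
  obtain ⟨b₀, b₁, b₂, hb⟩ := exists_eq_quadratic hfin (θ := t) (fun b₀ b₁ b₂ h => by
    rw [← p.v.gauge_eq_top_iff 1, ← one_nsmul (p.v.gauge _ _ _ _), ← hquad, h, P.v.map_zero]) y
  obtain ⟨z, hz⟩ : ∃ z, z = y - algebraMap K L b₀ := ⟨_, rfl⟩
  have hz0 : z ≠ 0 := fun h => hyK b₀ (sub_eq_zero.1 (hz ▸ h))
  obtain ⟨d, hd⟩ := P.exists_coe_of_ne_zero hz0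
  have h3 : 0 < 3 := by norm_num
  -- The values of `b₁ t` and `b₂ t ^ 2` are 1 and 2 modulo 3.
  have hd3 : ¬ 3 ∣ d := by
    have h := hquad 0 b₁ b₂
    rw [map_zero, zero_add, one_nsmul, show algebraMap K L b₁ * t + algebraMap K L b₂ * t ^ 2 = z by
      rw [hz]; linear_combination -hb, hd] at h
    simp only [AddValuation.gauge, p.v.map_zero] at h
    generalize p.v b₁ = u₁ at h
    generalize p.v b₂ = u₂ at h
    induction u₁ using WithTop.recTopCoe <;> induction u₂ using WithTop.recTopCoe <;>
      simp only [WithTop.nsmul_top_of_pos h3, WithTop.nsmul_coe_int, ← WithTop.coe_add,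
        ← WithTop.coe_min, WithTop.top_add, min_top_left, min_top_right, WithTop.coe_inj,
        WithTop.coe_ne_top] at h <;>
      push_cast at h <;> omega
  obtain ⟨c, hc⟩ : ∃ c, c = b₀ ^ 3 - 3 * b₀ - a := ⟨_, rfl⟩
  have hz3 : P.v (z ^ 3) = ((3 * d : ℤ) : WithTop ℤ) := by
    rw [P.v.map_pow, hd, WithTop.nsmul_coe_int]; rfl
  have hrel : z ^ 3 = algebraMap K L (-c) + algebraMap K L (-(3 * (b₀ ^ 2 - 1))) * z +
      algebraMap K L (-(3 * b₀)) * z ^ 2 := by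
    simp only [hc, hz, map_neg, map_sub, map_mul, map_pow, map_ofNat, map_one]
    linear_combination hy
  rw [hrel, p.v.map_quadratic P.v (f := 1) one_pos hd3 hP (by simpa using hd), one_nsmul] at hz3
  have hv3 : p.v (3 : K) = 0 := by
    exact_mod_cast p.map_intCast_eq_zero (m := 3) (by exact_mod_cast hchar)
  simp only [AddValuation.gauge, AddValuation.map_neg, AddValuation.map_mul, hv3, zero_add] at hz3
  -- The minimum `3 d` is divisible by 3, so only the constant term can attain it.
  have hvals : p.v c = (d : WithTop ℤ) ∧ ((d : ℤ) : WithTop ℤ) < 3 • p.v b₀ ∧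
      ((2 * d : ℤ) : WithTop ℤ) < 3 • p.v (b₀ ^ 2 - 1) := by
    generalize p.v c = u₀ at hz3 ⊢
    generalize p.v (b₀ ^ 2 - 1) = u₁ at hz3 ⊢
    generalize p.v b₀ = u₂ at hz3 ⊢
    induction u₀ using WithTop.recTopCoe <;> induction u₁ using WithTop.recTopCoe <;>
      induction u₂ using WithTop.recTopCoe <;>
      simp only [WithTop.nsmul_top_of_pos h3, WithTop.nsmul_coe_int, ← WithTop.coe_add,
        ← WithTop.coe_min, WithTop.top_add, min_top_left, min_top_right, WithTop.coe_inj,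
        WithTop.top_ne_coe, WithTop.coe_lt_top, WithTop.coe_lt_coe, and_true, true_and] at hz3 ⊢ <;>
      push_cast at hz3 ⊢ <;> omega
  obtain ⟨hvc, hvb, hvb1⟩ := hvals
  -- If `d ≥ 0`, then `b₀` has positive value and `b₀ ^ 2 - 1` is a unit, forcing `2 d < 0`.
  have hdneg : d < 0 := by
    by_contra! hd0
    have hb0 : 0 < p.v b₀ := by
      rw [← (WithTop.strictMono_nsmul_int h3).lt_iff_lt (a := 0), nsmul_zero]
      exact lt_of_le_of_lt (by exact_mod_cast hd0) hvb
    have hb2 : p.v (b₀ ^ 2 - 1) = 0 := by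
      rw [p.v.map_sub_eq_of_lt_right, p.v.map_one]
      rw [p.v.map_one, p.v.map_pow, two_nsmul]
      exact hb0.trans_le (le_add_of_nonneg_left hb0.le)
    rw [hb2, nsmul_zero] at hvb1
    have : 2 * d < 0 := by exact_mod_cast hvb1
    omega
  refine ⟨d, ?_, hdneg, hd3⟩
  have hb3 : ((d : ℤ) : WithTop ℤ) < p.v (b₀ ^ 3 - 3 * b₀) := by
    refine (lt_min ?_ ?_).trans_le (p.v.map_sub _ _)
    · rwa [p.v.map_pow]
    · rw [p.v.map_mul, hv3, zero_add]
      generalize p.v b₀ = u at hvb ⊢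
      induction u using WithTop.recTopCoe with
      | top => exact WithTop.coe_lt_top _
      | coe u =>
        rw [WithTop.nsmul_coe_int, WithTop.coe_lt_coe] at hvb
        rw [WithTop.coe_lt_coe]
        push_cast at hvb
        omega
  have hac : a = b₀ ^ 3 - 3 * b₀ - c := by rw [hc]; ring
  rw [hac, p.v.map_sub_eq_of_lt_right, hvc]
  rwa [hvc]

end Place

theorem mainTheorem7 {k K L : Type*} [Field k] [Finite k] [Field K] [Field L]
    [Algebra k K] [Algebra k⟮X⟯ K] [IsScalarTower k k⟮X⟯ K] [FunctionField k K]
    [Algebra k L] [Algebra K L] [IsScalarTower k K L]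
    (hchar : ringChar K ≠ 3) (hL : IsImpurelyCubic K L)
    (a : K) (y : L) (hy : K⟮y⟯ = ⊤) (hmin : minpoly K y = X ^ 3 - 3 * X - C a) :
    {p : Place k K | p.IsFullyRamified L} =
      {p : Place k K | ∃ n : ℤ, p.v a = (n : WithTop ℤ) ∧ n < 0 ∧ Int.gcd n 3 = 1} := by
  have hfin := hL.1
  have hgcd (n : ℤ) : Int.gcd n 3 = 1 ↔ ¬ 3 ∣ n := by
    rw [Int.gcd_comm, ← Int.isCoprime_iff_gcd_eq_one, Int.prime_three.coprime_iff_not_dvd]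
  have hchar3 : (3 : K) ≠ 0 := by
    intro h
    have hdvd : ringChar K ∣ 3 := (ringChar.spec K 3).1 (by exact_mod_cast h)
    rcases (Nat.dvd_prime Nat.prime_three).1 hdvd with h1 | h1
    · exact CharP.ringChar_ne_one h1
    · exact hchar h1
  have hroot : y ^ 3 = 3 * y + algebraMap K L a := by
    have h := minpoly.aeval K y
    simp only [hmin, map_sub, map_mul, map_pow, aeval_X, aeval_C, map_ofNat] at h
    linear_combination h
  have hdeg : (minpoly K y).degree = 3 := by
    rw [hmin]
    compute_degree!
  have hind (b₀ b₁ b₂ : K)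
      (h : algebraMap K L b₀ + algebraMap K L b₁ * y + algebraMap K L b₂ * y ^ 2 = 0) :
      b₀ = 0 ∧ b₁ = 0 ∧ b₂ = 0 := by
    have hq : C b₀ + C b₁ * X + C b₂ * X ^ 2 = 0 := by
      by_contra hne
      have h1 := minpoly.degree_le_of_ne_zero K y hne (by simpa using h)
      have h2 : (C b₀ + C b₁ * X + C b₂ * X ^ 2).degree ≤ 2 := by compute_degree
      rw [hdeg] at h1
      exact absurd (h1.trans h2) (by decide)
    refine ⟨?_, ?_, ?_⟩
    · simpa [coeff_X, coeff_C, coeff_X_pow] using congrArg (coeff · 0) hq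
    · simpa [coeff_X, coeff_C, coeff_X_pow] using congrArg (coeff · 1) hq
    · simpa [coeff_X, coeff_C, coeff_X_pow] using congrArg (coeff · 2) hq
  have hyK (b : K) : y ≠ algebraMap K L b := by
    intro h
    have := hind (-b) 1 0 (by simp [h])
    simp at this
  ext p
  simp only [Set.mem_ofPred_eq, hgcd]
  refine ⟨fun hp => hp.value_of_cubic hchar3 hfin hroot hyK, ?_⟩
  rintro ⟨n, ha, hneg, hn⟩
  exact p.isFullyRamified_of_cubic hfin hroot hind hn hneg ha
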